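/- Let $n,m\ge 1$ be integers and let $\Theta\in\mathbb{C}^{n\times m}$ be a phase matrix, i.e. $|\Theta_{ij}|=1$ for all $i,j$. Its phase rank is $$\mathrm{rank}_{\mathrm{phase}}(\Theta)=\min\Big\{\mathrm{rank}(M): M\in(\mathbb{C}\setminus\{0\})^{n\times m},\ \frac{M_{ij}}{|M_{ij}|}=\Theta_{ij}\ \text{for all } i,j\Big\}.$$ For $A\in\mathbb{C}^{n\times m}$ let $$\gamma_2(A)=\min\Big\{\max_{i,j}\|x_i\|_{2}\,\|y_j\|_{2}: XY^T=A\Big\},$$ where $X$ and $Y$ range over the complex matrices of sizes $n\times k$ and $m\times k$, with $k$ arbitrary, and $x_1,\dots,x_n$ and $y_1,\dots,y_m$ are the rows of $X$ and of $Y$; and let $$\gamma_2^*(A)=\max_{B\in\mathbb{C}^{n\times m}:\ \gamma_2(B)\le 1}|\mathrm{Tr}(A^*B)|.$$ Then $$\mathrm{rank}_{\mathrm{phase}}(\Theta)\ \ge\ \frac{nm}{\gamma_2^*(\Theta)}.$$ -/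

import Mathlib

noncomputable section

/-- A phase matrix: a complex matrix all of whose entries have modulus one. -/
def IsPhaseMatrix {n m : ℕ} (Θ : Matrix (Fin n) (Fin m) ℂ) : Prop :=
  ∀ i j, ‖Θ i j‖ = 1

/-- The matrix `M` has nonzero entries, and the phase `M i j / |M i j|` of each of them is
`Θ i j`. -/
def HasPhase {n m : ℕ} (M Θ : Matrix (Fin n) (Fin m) ℂ) : Prop :=
  ∀ i j, M i j ≠ 0 ∧ M i j / (‖M i j‖ : ℂ) = Θ i j

/-- The phase rank: the smallest rank of a complex matrix with nonzero entries whose entrywise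
phases are those of `Θ`. -/
def phaseRank {n m : ℕ} (Θ : Matrix (Fin n) (Fin m) ℂ) : ℕ :=
  sInf {r : ℕ | ∃ M : Matrix (Fin n) (Fin m) ℂ, HasPhase M Θ ∧ M.rank = r}

/-- The largest product `‖x_i‖ ‖y_j‖` of the Euclidean norms of a row of `X` and a row of `Y`. -/
def maxRowNormProd {n m k : ℕ} (X : Matrix (Fin n) (Fin k) ℂ) (Y : Matrix (Fin m) (Fin k) ℂ) : ℝ :=
  ⨆ p : Fin n × Fin m, ‖WithLp.toLp 2 (X p.1)‖ * ‖WithLp.toLp 2 (Y p.2)‖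

/-- The values `max_{i,j} ‖x_i‖ ‖y_j‖` over all factorizations `X Yᵀ = A` (with any inner
dimension). -/
def gamma2Values {n m : ℕ} (A : Matrix (Fin n) (Fin m) ℂ) : Set ℝ :=
  {c : ℝ | ∃ (k : ℕ) (X : Matrix (Fin n) (Fin k) ℂ) (Y : Matrix (Fin m) (Fin k) ℂ),
    X * Y.transpose = A ∧ c = maxRowNormProd X Y}

/-- The factorization norm `γ₂` (the max-norm). -/
def gamma2 {n m : ℕ} (A : Matrix (Fin n) (Fin m) ℂ) : ℝ :=
  sInf (gamma2Values A)

/-- The values `|⟨A, B⟩| = |Tr(A* B)|` over all `B` in the unit ball of `γ₂`. -/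
def gamma2DualValues {n m : ℕ} (A : Matrix (Fin n) (Fin m) ℂ) : Set ℝ :=
  {r : ℝ | ∃ B : Matrix (Fin n) (Fin m) ℂ, gamma2 B ≤ 1 ∧
    r = ‖(A.conjTranspose * B).trace‖}

/-- The dual norm `γ₂*` of `γ₂`. -/
def gamma2Dual {n m : ℕ} (A : Matrix (Fin n) (Fin m) ℂ) : ℝ :=
  sSup (gamma2DualValues A)

/-! The sets of which the infima and suprema are taken are nonempty and suitably bounded. -/

theorem exists_rank_eq_phaseRank {n m : ℕ} {Θ : Matrix (Fin n) (Fin m) ℂ}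
    (hΘ : IsPhaseMatrix Θ) :
    ∃ M : Matrix (Fin n) (Fin m) ℂ, HasPhase M Θ ∧ M.rank = phaseRank Θ := by
  refine Nat.sInf_mem
    (s := {r : ℕ | ∃ M : Matrix (Fin n) (Fin m) ℂ, HasPhase M Θ ∧ M.rank = r})
    ⟨Θ.rank, Θ, fun i j => ⟨?_, ?_⟩, rfl⟩
  · intro h
    have := hΘ i j
    simp [h] at this
  · simp [hΘ i j]

theorem le_maxRowNormProd {n m k : ℕ} (X : Matrix (Fin n) (Fin k) ℂ)
    (Y : Matrix (Fin m) (Fin k) ℂ) (i : Fin n) (j : Fin m) :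
    ‖WithLp.toLp 2 (X i)‖ * ‖WithLp.toLp 2 (Y j)‖ ≤ maxRowNormProd X Y :=
  le_ciSup (f := fun p : Fin n × Fin m =>
    ‖WithLp.toLp 2 (X p.1)‖ * ‖WithLp.toLp 2 (Y p.2)‖) (Set.finite_range _).bddAbove (i, j)

theorem gamma2Values_nonempty {n m : ℕ} (A : Matrix (Fin n) (Fin m) ℂ) :
    (gamma2Values A).Nonempty :=
  ⟨_, m, A, 1, by simp, rfl⟩

theorem gamma2Values_bddBelow {n m : ℕ} (A : Matrix (Fin n) (Fin m) ℂ) :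
    BddBelow (gamma2Values A) := by
  refine ⟨0, ?_⟩
  rintro _ ⟨k, X, Y, -, rfl⟩
  exact Real.iSup_nonneg fun p => by positivity

theorem norm_entry_le_gamma2 {n m : ℕ} (A : Matrix (Fin n) (Fin m) ℂ) (i : Fin n) (j : Fin m) :
    ‖A i j‖ ≤ gamma2 A := by
  refine le_csInf (gamma2Values_nonempty A) ?_
  rintro _ ⟨k, X, Y, rfl, rfl⟩
  refine le_trans ?_ (le_maxRowNormProd X Y i j)
  have h := norm_inner_le_norm (𝕜 := ℂ) (WithLp.toLp 2 (star (X i))) (WithLp.toLp 2 (Y j))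
  have h1 : inner ℂ (WithLp.toLp 2 (star (X i))) (WithLp.toLp 2 (Y j))
      = (X * Y.transpose) i j := by
    simp [PiLp.inner_apply, Matrix.mul_apply, mul_comm]
  have h2 : ‖WithLp.toLp 2 (star (X i))‖ = ‖WithLp.toLp 2 (X i)‖ := by
    simp [EuclideanSpace.norm_eq]
  rwa [h1, h2] at h

theorem gamma2DualValues_bddAbove {n m : ℕ} (A : Matrix (Fin n) (Fin m) ℂ) :
    BddAbove (gamma2DualValues A) := by
  refine ⟨∑ j, ∑ i, ‖A i j‖, ?_⟩
  rintro _ ⟨B, hB, rfl⟩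
  simp only [Matrix.trace, Matrix.diag, Matrix.mul_apply, Matrix.conjTranspose_apply]
  refine (norm_sum_le _ _).trans (Finset.sum_le_sum fun j _ => ?_)
  refine (norm_sum_le _ _).trans (Finset.sum_le_sum fun i _ => ?_)
  rw [norm_mul, norm_star]
  exact mul_le_of_le_one_right (norm_nonneg _) ((norm_entry_le_gamma2 B i j).trans hB)

theorem norm_entry_le_gamma2Dual {n m : ℕ} (A : Matrix (Fin n) (Fin m) ℂ)
    (i : Fin n) (j : Fin m) : ‖A i j‖ ≤ gamma2Dual A := by
  refine le_csSup (gamma2DualValues_bddAbove A) ⟨Matrix.single i j 1, ?_, ?_⟩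
  · refine (csInf_le (gamma2Values_bddBelow _)
      ⟨1, Matrix.single i 0 1, Matrix.single j 0 1, by simp, rfl⟩).trans ?_
    have : Nonempty (Fin n × Fin m) := ⟨(i, j)⟩
    refine ciSup_le fun p => mul_le_one₀ ?_ (norm_nonneg _) ?_
    · simp only [EuclideanSpace.norm_eq, Matrix.single_apply]
      simp; split_ifs <;> simp
    · simp only [EuclideanSpace.norm_eq, Matrix.single_apply]
      simp; split_ifs <;> simp
  · simp [Matrix.trace_mul_single]

end

/-! Let `M` have phases `Θ` and rank `d`, and write `M = X Yᵀ` with inner dimension `d`. Replacing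
`x_i` by `A x_i` and `y_j` by `A⁻ᵀ y_j` keeps `M`; normalising the new rows then gives a matrix `B`
with the phases of `M` and `γ₂(B) ≤ 1`, so `∑ |B i j|` is at most `γ₂*(Θ)`. If `A` puts the `x_i` in
radial isotropic position, each column satisfies `∑_i |B i j|² ≥ n/d`; as `|B i j| ≤ 1`, summing the
columns gives `nm/d ≤ γ₂*(Θ)`. Such an `A` need not exist for arbitrary `x_i`, so the squared norms
are regularised by `ε`. A maximiser of a determinant ratio then exists, and rank-one stretches of it
give the isotropy inequality (`exists_det_ne_zero_forall_le_mul_sum`). The error is `O(ε)` uniformly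
in `A`, and `ε → 0` finishes. -/

open Matrix Filter Topology

/-! ### Squared norms and rank-one stretches. -/

/-- The square of the Euclidean norm of a complex vector. -/
noncomputable def sqNorm {d : ℕ} (v : Fin d → ℂ) : ℝ := ∑ k, ‖v k‖ ^ 2

theorem norm_toLp_sq {d : ℕ} (v : Fin d → ℂ) : ‖WithLp.toLp 2 v‖ ^ 2 = sqNorm v := by
  simp [EuclideanSpace.norm_sq_eq, sqNorm]

theorem sqNorm_nonneg {d : ℕ} (v : Fin d → ℂ) : 0 ≤ sqNorm v :=
  Finset.sum_nonneg fun _ _ => by positivity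

theorem sqNorm_pos {d : ℕ} {v : Fin d → ℂ} (hv : v ≠ 0) : 0 < sqNorm v := by
  obtain ⟨k, hk⟩ := Function.ne_iff.1 hv
  exact Finset.sum_pos' (fun _ _ => by positivity)
    ⟨k, Finset.mem_univ k, by have : 0 < ‖v k‖ := norm_pos_iff.2 hk
                              positivity⟩

theorem sqNorm_smul {d : ℕ} (c : ℂ) (v : Fin d → ℂ) : sqNorm (c • v) = ‖c‖ ^ 2 * sqNorm v := by
  simp [sqNorm, Finset.mul_sum, mul_pow]

theorem continuous_sqNorm {d : ℕ} : Continuous (sqNorm (d := d)) := by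
  unfold sqNorm
  fun_prop

theorem norm_dotProduct_le {d : ℕ} (u v : Fin d → ℂ) :
    ‖u ⬝ᵥ v‖ ≤ ‖WithLp.toLp 2 u‖ * ‖WithLp.toLp 2 v‖ := by
  have h := norm_inner_le_norm (𝕜 := ℂ) (WithLp.toLp 2 (star u)) (WithLp.toLp 2 v)
  have h1 : inner ℂ (WithLp.toLp 2 (star u)) (WithLp.toLp 2 v) = u ⬝ᵥ v := by
    simp [PiLp.inner_apply, dotProduct, mul_comm]
  have h2 : ‖WithLp.toLp 2 (star u)‖ = ‖WithLp.toLp 2 u‖ := by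
    simp [EuclideanSpace.norm_eq]
  rwa [h1, h2] at h

theorem norm_dotProduct_sq_le {d : ℕ} (u v : Fin d → ℂ) :
    ‖u ⬝ᵥ v‖ ^ 2 ≤ sqNorm u * sqNorm v := by
  rw [← norm_toLp_sq, ← norm_toLp_sq, ← mul_pow]
  exact pow_le_pow_left₀ (norm_nonneg _) (norm_dotProduct_le u v) 2

/-- Stretching by the factor `1 + t` in the direction of a unit vector. -/
noncomputable def stretch {d : ℕ} (p : Fin d → ℂ) (t : ℝ) : Matrix (Fin d) (Fin d) ℂ :=
  1 + vecMulVec ((t : ℂ) • star p) p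

theorem det_stretch {d : ℕ} {p : Fin d → ℂ} (hp : sqNorm p = 1) (t : ℝ) :
    (stretch p t).det = 1 + t := by
  have h : p ⬝ᵥ star p = 1 := by
    have : ((sqNorm p : ℝ) : ℂ) = 1 := by rw [hp]; simp
    rw [← this, sqNorm]
    simp [dotProduct, Complex.mul_conj, Complex.normSq_eq_norm_sq]
  rw [stretch, vecMulVec_eq Unit, det_one_add_replicateCol_mul_replicateRow]
  simp [h]

/-- Only the component of `u` along `star p` is scaled, by `1 + t`, and `(1 + t)² - 1 = 2t + t²`. -/
theorem sqNorm_stretch_mulVec {d : ℕ} {p : Fin d → ℂ} (hp : sqNorm p = 1) (t : ℝ)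
    (u : Fin d → ℂ) :
    sqNorm (stretch p t *ᵥ u) = sqNorm u + (2 * t + t ^ 2) * ‖p ⬝ᵥ u‖ ^ 2 := by
  have h1 : stretch p t *ᵥ u = fun k => u k + t * (p ⬝ᵥ u) * star (p k) := by
    ext k
    simp [stretch, add_mulVec, smul_mulVec, vecMulVec_mulVec]
    ring
  have key : ∀ k, ‖u k + t * (p ⬝ᵥ u) * star (p k)‖ ^ 2 =
      ‖u k‖ ^ 2 + 2 * t * (p k * u k * star (p ⬝ᵥ u)).re
        + t ^ 2 * ‖p ⬝ᵥ u‖ ^ 2 * ‖p k‖ ^ 2 := by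
    intro k
    simp only [← Complex.normSq_eq_norm_sq, Complex.normSq_apply]
    simp
    ring
  rw [h1]
  simp only [sqNorm, key, Finset.sum_add_distrib, ← Finset.mul_sum]
  have hre : ∑ k, (p k * u k * star (p ⬝ᵥ u)).re = ‖p ⬝ᵥ u‖ ^ 2 := by
    rw [← Complex.re_sum, ← Finset.sum_mul]
    change ((p ⬝ᵥ u) * star (p ⬝ᵥ u)).re = _
    rw [Complex.star_def, Complex.mul_conj, Complex.ofReal_re, Complex.normSq_eq_norm_sq]
  change ∑ k, ‖p k‖ ^ 2 = 1 at hp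
  rw [hre, hp]
  ring

/-! ### The extremal matrix and regularised isotropic position. -/

/-- The squared norm of `A x`, regularised by `ε` times the squared Frobenius norm of `A`. -/
noncomputable def regSqNorm {d : ℕ} (ε : ℝ) (x : Fin d → ℂ) (A : Matrix (Fin d) (Fin d) ℂ) : ℝ :=
  sqNorm (A *ᵥ x) + ε * ∑ k, sqNorm (A.col k)

theorem continuous_regSqNorm {d : ℕ} (ε : ℝ) (x : Fin d → ℂ) : Continuous (regSqNorm ε x) := by
  unfold regSqNorm
  refine (continuous_sqNorm.comp (by fun_prop)).add
    (continuous_const.mul (continuous_finsetSum _ fun k _ => continuous_sqNorm.comp ?_))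
  exact continuous_pi fun i => continuous_id.matrix_elem i k

theorem regSqNorm_pos {d : ℕ} {ε : ℝ} (hε : 0 < ε) (x : Fin d → ℂ)
    {A : Matrix (Fin d) (Fin d) ℂ} (hA : A ≠ 0) : 0 < regSqNorm ε x A := by
  have : ∃ k, A.col k ≠ 0 := by
    by_contra! h
    exact hA (by ext i k; exact congrFun (h k) i)
  obtain ⟨k, hk⟩ := this
  exact add_pos_of_nonneg_of_pos (sqNorm_nonneg _) (mul_pos hε
    (Finset.sum_pos' (fun _ _ => sqNorm_nonneg _) ⟨k, Finset.mem_univ k, sqNorm_pos hk⟩))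

theorem regSqNorm_smul {d : ℕ} (ε : ℝ) (x : Fin d → ℂ) (c : ℂ) (A : Matrix (Fin d) (Fin d) ℂ) :
    regSqNorm ε x (c • A) = ‖c‖ ^ 2 * regSqNorm ε x A := by
  have : ∀ k, (c • A).col k = c • A.col k := fun k => rfl
  simp only [regSqNorm, this, smul_mulVec, sqNorm_smul, ← Finset.mul_sum]
  ring

theorem regSqNorm_stretch_mul {d : ℕ} (ε : ℝ) (x : Fin d → ℂ) {p : Fin d → ℂ}
    (hp : sqNorm p = 1) (t : ℝ) (A : Matrix (Fin d) (Fin d) ℂ) :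
    regSqNorm ε x (stretch p t * A) = regSqNorm ε x A +
      (2 * t + t ^ 2) * (‖p ⬝ᵥ A *ᵥ x‖ ^ 2 + ε * ∑ k, ‖(p ᵥ* A) k‖ ^ 2) := by
  have : ∀ k, (stretch p t * A).col k = stretch p t *ᵥ A.col k := fun k => rfl
  simp only [regSqNorm, this, ← mulVec_mulVec, sqNorm_stretch_mulVec hp,
    Finset.sum_add_distrib, ← Finset.mul_sum]
  change _ = _ + _ * (_ + _ * ∑ k, ‖p ⬝ᵥ A.col k‖ ^ 2)
  ring

/-- The degree-zero homogeneous ratio of a power of `|det A|` and the product of the regularised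
squared norms of the `A x_i` is maximised by some invertible `A`. -/
theorem exists_det_ne_zero_forall_det_pow_mul_le {n d : ℕ} (hd : 0 < d) {ε : ℝ} (hε : 0 < ε)
    (hn : 0 < n) (x : Fin n → Fin d → ℂ) :
    ∃ A : Matrix (Fin d) (Fin d) ℂ, A.det ≠ 0 ∧ ∀ A' : Matrix (Fin d) (Fin d) ℂ,
      ‖A'.det‖ ^ (2 * n) * (∏ i, regSqNorm ε (x i) A) ^ d ≤
        ‖A.det‖ ^ (2 * n) * (∏ i, regSqNorm ε (x i) A') ^ d := by
  have : Nonempty (Fin d) := ⟨⟨0, hd⟩⟩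
  let : NormedAddCommGroup (Matrix (Fin d) (Fin d) ℂ) := Matrix.normedAddCommGroup
  let : NormedSpace ℂ (Matrix (Fin d) (Fin d) ℂ) := Matrix.normedSpace
  have hpos : ∀ {A : Matrix (Fin d) (Fin d) ℂ}, A ≠ 0 →
      0 < (∏ i, regSqNorm ε (x i) A) ^ d := fun hA =>
    pow_pos (Finset.prod_pos fun i _ => regSqNorm_pos hε _ hA) d
  let h : Matrix (Fin d) (Fin d) ℂ → ℝ := fun A =>
    ‖A.det‖ ^ (2 * n) / (∏ i, regSqNorm ε (x i) A) ^ d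
  have hsmul : ∀ (c : ℂ) (A : Matrix (Fin d) (Fin d) ℂ), c ≠ 0 → h (c • A) = h A := by
    intro c A hc
    have hc' : ‖c‖ ≠ 0 := norm_ne_zero_iff.2 hc
    have e : ‖c‖ ^ (2 * n * d) ≠ 0 := pow_ne_zero _ hc'
    simp only [h, det_smul, regSqNorm_smul, Finset.prod_mul_distrib, Finset.prod_const,
      Finset.card_univ, Fintype.card_fin, norm_mul, norm_pow, mul_pow, ← pow_mul]
    rw [show d * (2 * n) = 2 * n * d by ring, mul_div_mul_left _ _ e]
  have hK : IsCompact (Metric.sphere (0 : Matrix (Fin d) (Fin d) ℂ) 1) := by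
    have : ProperSpace (Matrix (Fin d) (Fin d) ℂ) := FiniteDimensional.proper ℂ _
    exact isCompact_sphere _ _
  have hunit : ∀ A : Matrix (Fin d) (Fin d) ℂ, A ≠ 0 →
      ((‖A‖⁻¹ : ℝ) : ℂ) ≠ 0 ∧ ((‖A‖⁻¹ : ℝ) : ℂ) • A ∈ Metric.sphere 0 1 := by
    intro A hA
    have : ‖A‖ ≠ 0 := norm_ne_zero_iff.2 hA
    refine ⟨by simpa using this, ?_⟩
    rw [mem_sphere_zero_iff_norm, norm_smul]
    simp [this]
  have h1 := hunit 1 one_ne_zero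
  -- The `ε` term keeps the denominator positive at singular `A` too, so the ratio is continuous on
  -- the whole sphere.
  have hcont : ContinuousOn h (Metric.sphere 0 1) := by
    refine ContinuousOn.div (Continuous.continuousOn ?_) (Continuous.continuousOn ?_) ?_
    · exact (continuous_id.matrix_det.norm).pow _
    · exact (continuous_finsetProd _ fun i _ => continuous_regSqNorm ε (x i)).pow _
    · intro A hA
      exact (hpos (ne_zero_of_mem_unit_sphere ⟨A, hA⟩)).ne'
  obtain ⟨A, hA, hmax⟩ := hK.exists_isMaxOn ⟨_, h1.2⟩ hcont
  have hA0 : A ≠ 0 := ne_zero_of_mem_unit_sphere ⟨A, hA⟩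
  have hle : ∀ A', A' ≠ 0 → h A' ≤ h A := fun A' hA' => by
    rw [← hsmul _ A' (hunit A' hA').1]
    exact hmax (hunit A' hA').2
  refine ⟨A, fun h0 => ?_, fun A' => ?_⟩
  · have h2 : 0 < h 1 := div_pos (by simp) (hpos one_ne_zero)
    have h3 : h A = 0 := by simp [h, h0, hn.ne']
    linarith [hle 1 one_ne_zero]
  · rcases eq_or_ne A' 0 with rfl | hA'
    · rw [det_zero, norm_zero, zero_pow (by omega), zero_mul]
      refine mul_nonneg (by positivity) (pow_nonneg (Finset.prod_nonneg fun i _ => ?_) _)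
      simp [regSqNorm, sqNorm, Matrix.col]
    · exact (div_le_div_iff₀ (hpos hA') (hpos hA0)).1 (hle A' hA')

/-- Both sides of `h` equal `1` at `s = 0`; this compares their right derivatives there, through
logarithms. -/
theorem le_mul_sum_of_one_add_pow_le {n d : ℕ} (r : Fin n → ℝ) (hr : ∀ i, 0 ≤ r i)
    (h : ∀ s : ℝ, 0 < s → (1 + s) ^ n ≤ (∏ i, (1 + s * r i)) ^ d) :
    (n : ℝ) ≤ d * ∑ i, r i := by
  have key : ∀ s : ℝ, 0 < s → (n : ℝ) ≤ (1 + s) * (d * ∑ i, r i) := by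
    intro s hs
    have h1 : (1 + s) ^ n ≤ Real.exp (s * (d * ∑ i, r i)) := by
      refine (h s hs).trans ?_
      have : ∏ i, (1 + s * r i) ≤ Real.exp (s * ∑ i, r i) := by
        rw [Finset.mul_sum, Real.exp_sum]
        refine Finset.prod_le_prod (fun i _ => ?_) fun i _ => ?_
        · have := hr i
          positivity
        · linarith [Real.add_one_le_exp (s * r i)]
      refine (pow_le_pow_left₀ (Finset.prod_nonneg fun i _ => ?_) this d).trans_eq ?_
      · have := hr i
        positivity
      · rw [← Real.exp_nat_mul]
        ring_nf
    have h2 : n * Real.log (1 + s) ≤ s * (d * ∑ i, r i) := by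
      rw [← Real.log_pow, ← Real.log_exp (s * (d * ∑ i, r i))]
      exact Real.log_le_log (by positivity) h1
    have h3 : s / (1 + s) ≤ Real.log (1 + s) := by
      have := Real.one_sub_inv_le_log_of_pos (x := 1 + s) (by positivity)
      have e : s / (1 + s) = 1 - (1 + s)⁻¹ := by field_simp; ring
      rwa [e]
    have h4 : n * (s / (1 + s)) ≤ s * (d * ∑ i, r i) :=
      (mul_le_mul_of_nonneg_left h3 (Nat.cast_nonneg n)).trans h2
    rw [← mul_div_assoc, div_le_iff₀ (by positivity)] at h4
    nlinarith
  have hlim : Tendsto (fun s : ℝ => (1 + s) * (d * ∑ i, r i)) (𝓝[>] 0)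
      (𝓝 ((1 + 0) * (d * ∑ i, r i))) :=
    (Continuous.tendsto (by fun_prop) 0).mono_left nhdsWithin_le_nhds
  rw [add_zero, one_mul] at hlim
  exact ge_of_tendsto hlim (eventually_nhdsWithin_of_forall fun s hs => key s hs)

/-- A regularised form of the radial isotropic position of the vectors `x_i`. -/
theorem exists_det_ne_zero_forall_le_mul_sum {n d : ℕ} (hn : 0 < n) (hd : 0 < d) {ε : ℝ}
    (hε : 0 < ε) (x : Fin n → Fin d → ℂ) :
    ∃ A : Matrix (Fin d) (Fin d) ℂ, A.det ≠ 0 ∧ ∀ p : Fin d → ℂ, sqNorm p = 1 →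
      (n : ℝ) ≤ d * ∑ i, (‖p ⬝ᵥ A *ᵥ x i‖ ^ 2 + ε * sqNorm (p ᵥ* A)) /
        regSqNorm ε (x i) A := by
  obtain ⟨A, hA, hmax⟩ := exists_det_ne_zero_forall_det_pow_mul_le hd hε hn x
  have : Nonempty (Fin d) := ⟨⟨0, hd⟩⟩
  have hA0 : A ≠ 0 := by
    rintro rfl
    simp at hA
  have hc : ∀ i, 0 < regSqNorm ε (x i) A := fun i => regSqNorm_pos hε _ hA0
  refine ⟨A, hA, fun p hp => le_mul_sum_of_one_add_pow_le _ (fun i => ?_) fun s hs => ?_⟩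
  · have := sqNorm_nonneg (p ᵥ* A)
    have := hc i
    positivity
  -- With `(1 + t)² = 1 + s`, maximality tested against `stretch p t * A` takes exactly the form of
  -- the preceding lemma.
  · let t := Real.sqrt (1 + s) - 1
    have ht : (1 + t) ^ 2 = 1 + s := by
      simp only [t, add_sub_cancel]
      exact Real.sq_sqrt (by positivity)
    have ht2 : 2 * t + t ^ 2 = s := by linarith
    have h := hmax (stretch p t * A)
    rw [det_mul, det_stretch hp, norm_mul, mul_pow] at h
    have hn1 : ‖(1 + t : ℂ)‖ ^ (2 * n) = (1 + s) ^ n := by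
      rw [pow_mul, ← ht]
      congr 1
      rw [← Complex.ofReal_one, ← Complex.ofReal_add, Complex.norm_real, Real.norm_eq_abs, sq_abs]
    have hprod : ∏ i, regSqNorm ε (x i) (stretch p t * A) =
        (∏ i, regSqNorm ε (x i) A) * ∏ i, (1 + s * ((‖p ⬝ᵥ A *ᵥ x i‖ ^ 2 +
          ε * sqNorm (p ᵥ* A)) / regSqNorm ε (x i) A)) := by
      rw [← Finset.prod_mul_distrib]
      refine Finset.prod_congr rfl fun i _ => ?_
      rw [regSqNorm_stretch_mul ε _ hp, ht2]
      change _ + s * (_ + ε * sqNorm (p ᵥ* A)) = _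
      have := (hc i).ne'
      field_simp
    rw [hn1, hprod, mul_pow] at h
    have hP : 0 < ‖A.det‖ ^ (2 * n) * (∏ i, regSqNorm ε (x i) A) ^ d := by
      have := norm_pos_iff.2 hA
      have := Finset.prod_pos (s := Finset.univ) fun i _ => hc i
      positivity
    refine le_of_mul_le_mul_left ?_ hP
    linarith

/-! ### Factorisations, phases and the dual norm. -/

theorem exists_mul_transpose_eq_of_rank {n m : ℕ} (M : Matrix (Fin n) (Fin m) ℂ) :
    ∃ (X : Matrix (Fin n) (Fin M.rank) ℂ) (Y : Matrix (Fin m) (Fin M.rank) ℂ),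
      X * Y.transpose = M := by
  let V := LinearMap.range M.mulVecLin
  let b : Module.Basis (Fin M.rank) ℂ V := Module.finBasisOfFinrankEq ℂ V rfl
  let c : Fin m → V := fun j => ⟨M *ᵥ Pi.single j 1, ⟨Pi.single j 1, rfl⟩⟩
  refine ⟨Matrix.of fun i k => (b k : Fin n → ℂ) i, Matrix.of fun j k => b.repr (c j) k, ?_⟩
  ext i j
  have h := congrArg (fun v : V => (v : Fin n → ℂ) i) (b.sum_repr (c j))
  simp only [Submodule.coe_sum, Submodule.coe_smul, Finset.sum_apply, Pi.smul_apply,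
    smul_eq_mul] at h
  have hc : (c j : Fin n → ℂ) i = M i j := by simp [c]
  rw [hc] at h
  simpa only [mul_apply, transpose_apply, of_apply, mul_comm] using h

theorem gamma2_le_one_of_rows {n m k : ℕ} (X : Matrix (Fin n) (Fin k) ℂ)
    (Y : Matrix (Fin m) (Fin k) ℂ) (hX : ∀ i, sqNorm (X i) ≤ 1) (hY : ∀ j, sqNorm (Y j) ≤ 1) :
    gamma2 (X * Y.transpose) ≤ 1 := by
  refine (csInf_le (gamma2Values_bddBelow _) ⟨k, X, Y, rfl, rfl⟩).trans ?_
  refine Real.iSup_le (fun p => mul_le_one₀ ?_ (norm_nonneg _) ?_) zero_le_one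
  · rw [← sq_le_one_iff₀ (norm_nonneg _), norm_toLp_sq]
    exact hX _
  · rw [← sq_le_one_iff₀ (norm_nonneg _), norm_toLp_sq]
    exact hY _

theorem HasPhase.star_mul {n m : ℕ} {M Θ : Matrix (Fin n) (Fin m) ℂ} (h : HasPhase M Θ)
    (i : Fin n) (j : Fin m) : star (Θ i j) * M i j = (‖M i j‖ : ℂ) := by
  obtain ⟨h0, h1⟩ := h i j
  have : (‖M i j‖ : ℂ) ≠ 0 := by simpa using h0
  rw [← h1]
  simp only [Complex.star_def, map_div₀, Complex.conj_ofReal]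
  rw [div_mul_eq_mul_div, mul_comm, Complex.mul_conj, Complex.normSq_eq_norm_sq]
  field_simp
  simp

/-- Nonnegative row and column scalings do not disturb the phases, so `Tr(Θ* B)` has no
cancellation. -/
theorem HasPhase.sum_norm_le_gamma2Dual {n m : ℕ} {M Θ B : Matrix (Fin n) (Fin m) ℂ}
    (h : HasPhase M Θ) (a : Fin n → ℝ) (b : Fin m → ℝ) (ha : ∀ i, 0 ≤ a i) (hb : ∀ j, 0 ≤ b j)
    (hB : ∀ i j, B i j = (a i * b j : ℝ) * M i j) (hB1 : gamma2 B ≤ 1) :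
    ∑ j, ∑ i, ‖B i j‖ ≤ gamma2Dual Θ := by
  refine le_csSup (gamma2DualValues_bddAbove Θ) ⟨B, hB1, ?_⟩
  have : (Θ.conjTranspose * B).trace = ((∑ j, ∑ i, ‖B i j‖ : ℝ) : ℂ) := by
    simp only [Matrix.trace, Matrix.diag, Matrix.mul_apply, Matrix.conjTranspose_apply,
      Complex.ofReal_sum]
    refine Finset.sum_congr rfl fun j _ => Finset.sum_congr rfl fun i _ => ?_
    rw [hB, mul_left_comm, h.star_mul, norm_mul, Complex.norm_real, Real.norm_eq_abs,
      abs_of_nonneg (mul_nonneg (ha i) (hb j))]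
    simp
  rw [this, Complex.norm_real, Real.norm_eq_abs, abs_of_nonneg (by positivity)]

/-! ### The rank bound. -/

/-- The coefficient of `ε` involves only `M` and `Y`, not the matrix `A`, which varies with `ε`;
this is what permits the limit. -/
theorem HasPhase.le_rank_mul_gamma2Dual_add {n m : ℕ} (hn : 0 < n) (hm : 0 < m)
    {M Θ : Matrix (Fin n) (Fin m) ℂ} (h : HasPhase M Θ)
    {d : ℕ} (X : Matrix (Fin n) (Fin d) ℂ) (Y : Matrix (Fin m) (Fin d) ℂ)
    (hXY : X * Y.transpose = M) {ε : ℝ} (hε : 0 < ε) :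
    (n * m : ℝ) ≤ d * (gamma2Dual Θ + ε * ∑ j, ∑ i, sqNorm (Y j) / ‖M i j‖ ^ 2) := by
  have hM : ∀ i j, M i j = Y j ⬝ᵥ X i := fun i j => by
    rw [← hXY, mul_apply, dotProduct]
    exact Finset.sum_congr rfl fun k _ => mul_comm _ _
  have hM0 : ∀ i j, 0 < ‖M i j‖ := fun i j => norm_pos_iff.2 (h i j).1
  have hd : 0 < d := by
    rcases Nat.eq_zero_or_pos d with rfl | hd
    · exact absurd (by simp [hM]) (h ⟨0, hn⟩ ⟨0, hm⟩).1
    · exact hd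
  obtain ⟨A, hA, hsum⟩ := exists_det_ne_zero_forall_le_mul_sum hn hd hε (fun i => X i)
  have hA0 : A ≠ 0 := by
    have : Nonempty (Fin d) := ⟨⟨0, hd⟩⟩
    rintro rfl
    simp at hA
  set c : Fin n → ℝ := fun i => regSqNorm ε (X i) A with hc_def
  have hc : ∀ i, 0 < c i := fun i => regSqNorm_pos hε _ hA0
  have huc : ∀ i, sqNorm (A *ᵥ X i) ≤ c i := fun i =>
    le_add_of_nonneg_right (mul_nonneg hε.le (Finset.sum_nonneg fun _ _ => sqNorm_nonneg _))
  set v : Fin m → Fin d → ℂ := fun j => Y j ᵥ* A⁻¹ with hv_def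
  have hvA : ∀ j, v j ᵥ* A = Y j := fun j => by
    rw [hv_def, vecMul_vecMul, nonsing_inv_mul _ (isUnit_iff_ne_zero.2 hA), vecMul_one]
  have hvM : ∀ i j, v j ⬝ᵥ A *ᵥ X i = M i j := fun i j => by
    rw [dotProduct_mulVec, hvA, hM]
  have hv : ∀ j, 0 < sqNorm (v j) := fun j => sqNorm_pos fun h0 => by
    have := hM0 ⟨0, hn⟩ j
    rw [← hvM, h0] at this
    simp at this
  -- The rows `A x_i` are divided by regularised norms, hence get length at most one; the rows `v j`
  -- must become exact unit vectors, to serve as `p` in `hsum`.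
  set a : Fin n → ℝ := fun i => (Real.sqrt (c i))⁻¹
  set b : Fin m → ℝ := fun j => (Real.sqrt (sqNorm (v j)))⁻¹
  have ha2 : ∀ i, a i ^ 2 = (c i)⁻¹ := fun i => by
    simp only [a, inv_pow, Real.sq_sqrt (hc i).le]
  have hb2 : ∀ j, b j ^ 2 = (sqNorm (v j))⁻¹ := fun j => by
    simp only [b, inv_pow, Real.sq_sqrt (hv j).le]
  have ha : ∀ i, 0 ≤ a i := fun i => by positivity
  have hb : ∀ j, 0 ≤ b j := fun j => by positivity
  let X' : Matrix (Fin n) (Fin d) ℂ := Matrix.of fun i => (a i : ℂ) • (A *ᵥ X i)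
  let Y' : Matrix (Fin m) (Fin d) ℂ := Matrix.of fun j => (b j : ℂ) • v j
  have hX' : ∀ i, sqNorm (X' i) ≤ 1 := fun i => by
    change sqNorm ((a i : ℂ) • (A *ᵥ X i)) ≤ 1
    rw [sqNorm_smul, Complex.norm_real, Real.norm_eq_abs, sq_abs, ha2, inv_mul_le_one₀ (hc i)]
    exact huc i
  have hY' : ∀ j, sqNorm (Y' j) = 1 := fun j => by
    change sqNorm ((b j : ℂ) • v j) = 1
    rw [sqNorm_smul, Complex.norm_real, Real.norm_eq_abs, sq_abs, hb2,
      inv_mul_cancel₀ (hv j).ne']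
  set B := X' * Y'.transpose with hB_def
  have hB : ∀ i j, B i j = (a i * b j : ℝ) * M i j := fun i j => by
    have : B i j = Y' j ⬝ᵥ X' i := by
      rw [hB_def, mul_apply, dotProduct]
      exact Finset.sum_congr rfl fun k _ => mul_comm _ _
    rw [this]
    change ((b j : ℂ) • v j) ⬝ᵥ ((a i : ℂ) • (A *ᵥ X i)) = _
    rw [smul_dotProduct, dotProduct_smul, hvM]
    simp only [smul_eq_mul, Complex.ofReal_mul]
    ring
  have hB1 : gamma2 B ≤ 1 := gamma2_le_one_of_rows X' Y' hX' fun j => (hY' j).le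
  have hle := h.sum_norm_le_gamma2Dual a b ha hb hB hB1
  have hentry : ∀ i j, (‖Y' j ⬝ᵥ A *ᵥ X i‖ ^ 2 + ε * sqNorm (Y' j ᵥ* A)) / c i ≤
      ‖B i j‖ + ε * (sqNorm (Y j) / ‖M i j‖ ^ 2) := by
    intro i j
    have e1 : ‖Y' j ⬝ᵥ A *ᵥ X i‖ ^ 2 / c i = ‖B i j‖ ^ 2 := by
      change ‖((b j : ℂ) • v j) ⬝ᵥ A *ᵥ X i‖ ^ 2 / c i = _
      rw [smul_dotProduct, hvM, hB]
      simp only [smul_eq_mul, norm_mul, Complex.norm_real, Real.norm_eq_abs, mul_pow, sq_abs,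
        ha2]
      field_simp
    have e2 : ‖B i j‖ ^ 2 ≤ ‖B i j‖ := by
      have := (norm_entry_le_gamma2 B i j).trans hB1
      nlinarith [norm_nonneg (B i j)]
    -- Cauchy–Schwarz gives `|M i j|² ≤ |v j|² c i`, which eliminates `A` from the error.
    have e3 : sqNorm (Y' j ᵥ* A) / c i ≤ sqNorm (Y j) / ‖M i j‖ ^ 2 := by
      change sqNorm (((b j : ℂ) • v j) ᵥ* A) / c i ≤ _
      rw [smul_vecMul, hvA, sqNorm_smul, Complex.norm_real, Real.norm_eq_abs, sq_abs, hb2,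
        inv_mul_eq_div, div_div]
      refine div_le_div_of_nonneg_left (sqNorm_nonneg _) (pow_pos (hM0 i j) 2) ?_
      rw [← hvM]
      exact (norm_dotProduct_sq_le _ _).trans
        (mul_le_mul_of_nonneg_left (huc i) (sqNorm_nonneg _))
    rw [add_div, e1, mul_div_assoc]
    exact add_le_add e2 (mul_le_mul_of_nonneg_left e3 hε.le)
  have hcol : ∀ j, (n : ℝ) ≤
      d * ∑ i, (‖B i j‖ + ε * (sqNorm (Y j) / ‖M i j‖ ^ 2)) := fun j =>
    (hsum (Y' j) (hY' j)).trans (mul_le_mul_of_nonneg_left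
      (Finset.sum_le_sum fun i _ => hentry i j) (Nat.cast_nonneg d))
  have htot := Finset.sum_le_sum fun j (_ : j ∈ Finset.univ) => hcol j
  simp only [Finset.sum_const, Finset.card_univ, Fintype.card_fin, nsmul_eq_mul,
    ← Finset.mul_sum, Finset.sum_add_distrib] at htot
  rw [mul_comm (n : ℝ)]
  refine htot.trans (mul_le_mul_of_nonneg_left ?_ (Nat.cast_nonneg d))
  linarith

theorem HasPhase.le_rank_mul_gamma2Dual {n m : ℕ} (hn : 0 < n) (hm : 0 < m)
    {M Θ : Matrix (Fin n) (Fin m) ℂ} (h : HasPhase M Θ) :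
    (n * m : ℝ) ≤ M.rank * gamma2Dual Θ := by
  obtain ⟨X, Y, hXY⟩ := exists_mul_transpose_eq_of_rank M
  set C := ∑ j, ∑ i, sqNorm (Y j) / ‖M i j‖ ^ 2
  have hlim : Tendsto (fun ε : ℝ => (M.rank : ℝ) * (gamma2Dual Θ + ε * C)) (𝓝[>] 0)
      (𝓝 (M.rank * (gamma2Dual Θ + 0 * C))) :=
    (Continuous.tendsto (by fun_prop) 0).mono_left nhdsWithin_le_nhds
  rw [zero_mul, add_zero] at hlim
  exact ge_of_tendsto hlim (eventually_nhdsWithin_of_forall fun ε hε =>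
    h.le_rank_mul_gamma2Dual_add hn hm X Y hXY hε)

theorem mainTheorem6 (n m : ℕ) (hn : 0 < n) (hm : 0 < m)
    (Θ : Matrix (Fin n) (Fin m) ℂ) (hΘ : IsPhaseMatrix Θ) :
    (n * m : ℝ) / gamma2Dual Θ ≤ (phaseRank Θ : ℝ) := by
  obtain ⟨M, hM, hrank⟩ := exists_rank_eq_phaseRank hΘ
  have hpos : 0 < gamma2Dual Θ := by
    have := norm_entry_le_gamma2Dual Θ ⟨0, hn⟩ ⟨0, hm⟩
    rw [hΘ] at this
    linarith
  rw [div_le_iff₀ hpos, ← hrank]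
  exact hM.le_rank_mul_gamma2Dual hn hm
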